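/- For $0\le m\le d$ let $M(d,m)$ be the space of affine $m$-planes in $\mathbb R^d$, topologized as a subspace of the Grassmannian $G(d+1,m+1)$ by identifying an $m$-plane $H$ with the $(m+1)$-dimensional linear subspace of $\mathbb R^{d+1}$ spanned by $\{1\}\times H$; here $G(n,k)$ denotes the Grassmannian of $k$-dimensional linear subspaces of $\mathbb R^n$. For a family $\mathcal F$ of compact convex sets in $\mathbb R^d$ let $\mathcal T_m(\mathcal F)\subset M(d,m)$ be the subspace of the $m$-planes that intersect every member of $\mathcal F$ (the $m$-transversals to $\mathcal F$). Theorem. Let $0\le\rho<m\le d-1$, let $\mathcal F=\{A_1,\dots,A_{\rho+2}\}$ be a family of $\rho+2$ compact convex sets in $\mathbb R^d$, and let $\alpha_i\in A_i$, $i=1,\dots,\rho+2$, be some points. Suppose that $\mathcal F$ has no $\rho$-transversal, that is, no affine $\rho$-plane intersects every $A_i$. Then the inclusion $$\mathcal T_m(\{\{\alpha_1\},\dots,\{\alpha_{\rho+2}\}\})\subset\mathcal T_m(\mathcal F)$$ is a homotopy equivalence. In particular, $\mathcal T_m(\mathcal F)$ has the homotopy type of $G(d-\rho-1,m-\rho-1)$,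 and if $m=\rho+1$, then $\mathcal T_m(\mathcal F)$ is contractible. -/

import Mathlib

open scoped ContinuousMap

noncomputable section

namespace PlaneTransversal

/-- Euclidean space `ℝⁿ`. -/
abbrev Euc (n : ℕ) : Type := EuclideanSpace ℝ (Fin n)

/-- The Grassmannian `G(n, k)` of `k`-dimensional linear subspaces of `ℝⁿ`. -/
def Gr (n k : ℕ) : Type :=
  {U : Submodule ℝ (Euc n) // Module.finrank ℝ U = k}

/-- The usual topology of the Grassmannian: a subspace is identified with the orthogonal projection
of `ℝⁿ` onto it, and `G(n, k)` carries the subspace topology from the space of linear operators. -/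
instance (n k : ℕ) : TopologicalSpace (Gr n k) :=
  TopologicalSpace.induced (fun U => U.1.starProjection)
    (inferInstance : TopologicalSpace (Euc n →L[ℝ] Euc n))

/-- The set `M(d, m)` of `m`-planes, that is, of nonempty affine subspaces of `ℝᵈ` of
dimension `m`. -/
def Plane (d m : ℕ) : Type :=
  {H : AffineSubspace ℝ (Euc d) //
    (H : Set (Euc d)).Nonempty ∧ Module.finrank ℝ H.direction = m}

/-- The embedding of `ℝᵈ` into `ℝᵈ⁺¹` as the affine hyperplane `x₀ = 1`, which misses the
origin. -/
def affLift {d : ℕ} (x : Euc d) : Euc (d + 1) :=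
  WithLp.toLp 2 (Fin.cons (1 : ℝ) (fun i => x i))

/-- The linear subspace of `ℝᵈ⁺¹` spanned by the copy of the plane `H` in the hyperplane
`x₀ = 1`. -/
def cone {d : ℕ} (H : AffineSubspace ℝ (Euc d)) : Submodule ℝ (Euc (d + 1)) :=
  Submodule.span ℝ (affLift '' (H : Set (Euc d)))

/-- The linear embedding of `ℝᵈ` into `ℝᵈ⁺¹` as the hyperplane `x₀ = 0`. -/
def linLift (d : ℕ) : Euc d →ₗ[ℝ] Euc (d + 1) where
  toFun x := WithLp.toLp 2 (Fin.cons (0 : ℝ) (fun i => x i))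
  map_add' x y := by
    ext i
    refine Fin.cases ?_ (fun j => ?_) i <;> simp
  map_smul' c x := by
    ext i
    refine Fin.cases ?_ (fun j => ?_) i <;> simp

theorem linLift_injective (d : ℕ) : Function.Injective (linLift d) := by
  intro x y h
  ext i
  have := congrArg (fun v : Euc (d + 1) => v i.succ) h
  simpa [linLift] using this

theorem lift_sub {d : ℕ} (x y : Euc d) : affLift x - affLift y = linLift d (x - y) := by
  ext i
  refine Fin.cases ?_ (fun j => ?_) i <;> simp [affLift, linLift]

theorem cone_eq {d : ℕ} (H : AffineSubspace ℝ (Euc d)) {p : Euc d} (hp : p ∈ H) :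
    cone H = H.direction.map (linLift d) ⊔ Submodule.span ℝ {affLift p} := by
  apply le_antisymm
  · refine Submodule.span_le.2 ?_
    rintro _ ⟨x, hx, rfl⟩
    have h : affLift x = linLift d (x - p) + affLift p := by rw [← lift_sub]; abel
    rw [h]
    exact Submodule.add_mem_sup
      (Submodule.mem_map_of_mem (AffineSubspace.vsub_mem_direction hx hp))
      (Submodule.mem_span_singleton_self _)
  · refine sup_le ?_ (Submodule.span_mono (by rintro _ rfl; exact ⟨p, hp, rfl⟩))
    rintro _ ⟨v, hv, rfl⟩
    have h : linLift d v = affLift (v + p) - affLift p := by rw [lift_sub]; simp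
    rw [h]
    exact Submodule.sub_mem _
      (Submodule.subset_span ⟨v + p, AffineSubspace.vadd_mem_of_mem_direction hv hp, rfl⟩)
      (Submodule.subset_span ⟨p, hp, rfl⟩)

theorem finrank_cone {d m : ℕ} (H : Plane d m) : Module.finrank ℝ (cone H.1) = m + 1 := by
  obtain ⟨H, ⟨p, hp⟩, hm⟩ := H
  have hne : affLift p ≠ 0 := by
    intro h
    have := congrArg (fun v : Euc (d + 1) => v 0) h
    simp [affLift] at this
  have hdis : H.direction.map (linLift d) ⊓ Submodule.span ℝ {affLift p} = ⊥ := by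
    rw [eq_bot_iff]
    rintro _ ⟨⟨v, -, rfl⟩, hx⟩
    obtain ⟨c, hc⟩ := Submodule.mem_span_singleton.1 hx
    have := congrArg (fun v : Euc (d + 1) => v 0) hc
    have hc0 : c = 0 := by simpa [affLift, linLift] using this
    simp [← hc, hc0]
  have h := Submodule.finrank_sup_add_finrank_inf_eq
    (H.direction.map (linLift d)) (Submodule.span ℝ {affLift p})
  rw [hdis, finrank_bot, finrank_span_singleton hne,
    ← (Submodule.equivMapOfInjective _ (linLift_injective d) H.direction).finrank_eq] at h
  change Module.finrank ℝ H.direction = m at hm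
  change Module.finrank ℝ (cone H) = m + 1
  rw [cone_eq H hp]
  omega

/-- The identification of an `m`-plane of `ℝᵈ` with a point of `G(d + 1, m + 1)`. -/
def Plane.toGr {d m : ℕ} (H : Plane d m) : Gr (d + 1) (m + 1) :=
  ⟨cone H.1, finrank_cone H⟩

/-- `M(d, m)` has the subspace topology from `G(d + 1, m + 1)`. -/
instance (d m : ℕ) : TopologicalSpace (Plane d m) :=
  TopologicalSpace.induced Plane.toGr inferInstance

/-- The space of `m`-transversals to the family `A`: the `m`-planes that intersect
every member of the family. -/
def transversals {d : ℕ} {ι : Type} (m : ℕ) (A : ι → Set (Euc d)) : Set (Plane d m) :=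
  {H | ∀ i, ((H.1 : Set (Euc d)) ∩ A i).Nonempty}

theorem transversals_mono {d : ℕ} {ι : Type} (m : ℕ) {A B : ι → Set (Euc d)}
    (h : ∀ i, A i ⊆ B i) : transversals m A ⊆ transversals m B :=
  fun _ hH i => (hH i).mono (Set.inter_subset_inter_right _ (h i))

/-- A continuous map is a homotopy equivalence. -/
def IsHomotopyEquiv {X Y : Type} [TopologicalSpace X] [TopologicalSpace Y] (f : C(X, Y)) : Prop :=
  ∃ e : X ≃ₕ Y, e.toFun = f

end PlaneTransversal

end

noncomputable section

namespace PlaneTransversal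

open Filter Topology ContinuousLinearMap

/-! Lift everything to ℝᵈ⁺¹: a plane becomes its cone `C`, and each `A i` a compact convex set `K i`
in the hyperplane x₀ = 1. A dependent tuple with entries in the `K i` would lie in a subspace of
dimension ρ + 1, which cuts out a ρ-transversal; hence all such tuples are independent
(`linearIndependent_of_no_transversal`). By compactness their left inverses are uniformly bounded,
so a small displacement of such a tuple extends to an invertible operator close to the identity
(`slide`).

Let `κ` be the lifted tuple `α`. One would like to choose points of `K i ∩ C` continuously in `C`
and push them along segments to `κ i`, dragging `C` along. Instead, at time t the point `v i ∈ K i`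
minimizes t times the squared distance to `κ i` plus a large multiple of the squared distance to
`C`. For t > 0 the minimizer is unique, hence continuous, and it lies within ε√t of `C`. The inverse
of a slide takes the projections of the `v i` to `C` back to the `v i`, and `transport` then carries
`v` the fraction t of the way to `κ`. At t = 0 the tuple `v` may jump, but both operators tend to 1
there, so their product is continuous (`exists_deformation`). By convexity the moved cone still
meets every `K i`; at t = 1 it contains every `κ i`, and a cone that already contains them never
moves. This is a strong deformation retraction.

Finally, subspaces containing the span of `κ` correspond to subspaces of its orthogonal complement,
which gives the Grassmannian (`nonempty_homeomorph_transversals_singleton`). -/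

/-! ### Moving a tuple of vectors by a linear map -/

/-- The linear map `ℝᵏ → ℝᴺ` with prescribed values on the standard basis, as a continuous linear
function of these values. -/
def tupleMap (N k : ℕ) : (Fin k → Euc N) →L[ℝ] (Euc k →L[ℝ] Euc N) :=
  LinearMap.toContinuousLinearMap
    { toFun := fun v => ∑ i, (EuclideanSpace.proj i : Euc k →L[ℝ] ℝ).smulRight (v i)
      map_add' := fun v w => by
        ext x; simp [Finset.sum_add_distrib]
      map_smul' := fun c v => by
        ext x; simp [Finset.smul_sum, smul_comm c, mul_left_comm] }

variable {N k d m r : ℕ}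

theorem tupleMap_apply (v : Fin k → Euc N) (x : Euc k) : tupleMap N k v x = ∑ i, x i • v i := by
  simp [tupleMap]

theorem tupleMap_single (v : Fin k → Euc N) (i : Fin k) :
    tupleMap N k v (EuclideanSpace.single i 1) = v i := by
  rw [tupleMap_apply, Finset.sum_eq_single i] <;> simp +contextual

theorem tupleMap_injective {v : Fin k → Euc N} (hv : LinearIndependent ℝ v) :
    Function.Injective (tupleMap N k v) := by
  rw [injective_iff_map_eq_zero]
  intro x hx
  rw [tupleMap_apply] at hx
  ext i
  exact Fintype.linearIndependent_iff.1 hv (fun i => x i) hx i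

theorem isUnit_of_injective {f : Euc N →L[ℝ] Euc N} (hf : Function.Injective f) : IsUnit f := by
  rw [ContinuousLinearMap.isUnit_iff_bijective]
  exact ⟨hf, (LinearMap.injective_iff_surjective (f := (f : Euc N →ₗ[ℝ] Euc N))).1 hf⟩

theorem isUnit_gram {v : Fin k → Euc N} (hv : LinearIndependent ℝ v) :
    IsUnit (adjoint (tupleMap N k v) ∘L tupleMap N k v) := by
  apply isUnit_of_injective
  rw [injective_iff_map_eq_zero]
  intro x hx
  apply (injective_iff_map_eq_zero _).1 (tupleMap_injective hv)
  have h : inner ℝ (adjoint (tupleMap N k v) (tupleMap N k v x)) x = 0 := by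
    rw [show adjoint (tupleMap N k v) (tupleMap N k v x) = 0 from hx, inner_zero_left]
  rwa [adjoint_inner_left, inner_self_eq_zero] at h

/-- The Moore-Penrose left inverse of `tupleMap N k v`, for independent `v`. -/
def leftInv (v : Fin k → Euc N) : Euc N →L[ℝ] Euc k :=
  Ring.inverse (adjoint (tupleMap N k v) ∘L tupleMap N k v) ∘L adjoint (tupleMap N k v)

theorem leftInv_apply {v : Fin k → Euc N} (hv : LinearIndependent ℝ v) (i : Fin k) :
    leftInv v (v i) = EuclideanSpace.single i 1 := by
  have h := Ring.inverse_mul_cancel _ (isUnit_gram hv)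
  have := congrArg (fun f => f (EuclideanSpace.single i (1 : ℝ))) h
  simpa [leftInv, tupleMap_single] using this

theorem continuousAt_leftInv {v : Fin k → Euc N} (hv : LinearIndependent ℝ v) :
    ContinuousAt leftInv v := by
  have h1 : Continuous fun v : Fin k → Euc N => tupleMap N k v := (tupleMap N k).continuous
  have h2 : Continuous fun v : Fin k → Euc N => adjoint (tupleMap N k v) :=
    (LinearIsometryEquiv.continuous _).comp h1
  have h3 : Continuous fun v : Fin k → Euc N => adjoint (tupleMap N k v) ∘L tupleMap N k v :=
    h2.clm_comp h1
  obtain ⟨u, hu⟩ := isUnit_gram hv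
  have h4 := NormedRing.inverse_continuousAt u
  rw [hu] at h4
  exact (ContinuousAt.comp (f := fun v => adjoint (tupleMap N k v) ∘L tupleMap N k v)
    (x := v) h4 h3.continuousAt).clm_comp h2.continuousAt

/-- A linear map that takes the tuple `v` to the tuple `w` and is close to the identity if `w` is
close to `v`. -/
def slide (v w : Fin k → Euc N) : Euc N →L[ℝ] Euc N :=
  1 + tupleMap N k (w - v) ∘L leftInv v

theorem slide_apply {v : Fin k → Euc N} (hv : LinearIndependent ℝ v) (w : Fin k → Euc N)
    (i : Fin k) : slide v w (v i) = w i := by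
  simp only [slide, add_apply, comp_apply, leftInv_apply hv, tupleMap_single]
  simp

theorem slide_self (v : Fin k → Euc N) : slide v v = 1 := by
  simp [slide]

theorem norm_slide_sub_one_le (v w : Fin k → Euc N) :
    ‖slide v w - 1‖ ≤ ‖tupleMap N k‖ * ‖w - v‖ * ‖leftInv v‖ := by
  rw [slide, add_sub_cancel_left]
  refine (opNorm_comp_le _ _).trans ?_
  gcongr
  exact le_opNorm _ _

theorem isUnit_slide {v w : Fin k → Euc N}
    (h : ‖tupleMap N k‖ * ‖w - v‖ * ‖leftInv v‖ < 1) : IsUnit (slide v w) := by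
  have := isUnit_one_sub_of_norm_lt_one (x := 1 - slide v w)
    (by rw [norm_sub_rev]; exact (norm_slide_sub_one_le v w).trans_lt h)
  simpa using this

theorem ContinuousAt.slide {Y : Type*} [TopologicalSpace Y] {v w : Y → Fin k → Euc N} {y : Y}
    (hv : ContinuousAt v y) (hw : ContinuousAt w y) (hi : LinearIndependent ℝ (v y)) :
    ContinuousAt (fun y => slide (v y) (w y)) y := by
  have h1 : ContinuousAt (fun y => leftInv (v y)) y :=
    ContinuousAt.comp (continuousAt_leftInv hi) hv
  have h2 : ContinuousAt (fun y => tupleMap N k (w y - v y)) y :=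
    (tupleMap N k).continuous.continuousAt.comp (hw.sub hv)
  exact continuousAt_const.add (h2.clm_comp h1)

/-- A bound independent of the tuple controls slides even where the tuple varies discontinuously. -/
theorem exists_norm_leftInv_le {P : Set (Fin k → Euc N)} (hP : IsCompact P)
    (hi : ∀ v ∈ P, LinearIndependent ℝ v) : ∃ M : ℝ, 0 < M ∧ ∀ v ∈ P, ‖leftInv v‖ ≤ M := by
  obtain ⟨M, hM⟩ := hP.exists_bound_of_continuousOn
    (f := leftInv) fun v hv => (continuousAt_leftInv (hi v hv)).continuousWithinAt
  exact ⟨max M 1, by positivity, fun v hv => (hM v hv).trans (le_max_left _ _)⟩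

/-! ### The action of invertible operators on subspaces -/

/-- Since e − e* is skew, ⟨(1 + e − e*)x, x⟩ = ‖x‖². -/
theorem isUnit_one_add_sub_adjoint (e : Euc N →L[ℝ] Euc N) : IsUnit (1 + e - adjoint e) := by
  apply isUnit_of_injective
  rw [injective_iff_map_eq_zero]
  intro x hx
  have h : inner ℝ ((1 + e - adjoint e) x) x = 0 := by rw [hx, inner_zero_left]
  simp only [sub_apply, add_apply, inner_sub_left, inner_add_left,
    adjoint_inner_left, real_inner_comm x (e x)] at h
  rw [real_inner_comm, add_sub_cancel_right] at h
  exact inner_self_eq_zero.1 h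

/-- Let P be the orthogonal projection. Then Pe = e and eP = P; the adjoint of the latter is Pe* =
P, so P(1 + e − e*) = e. Thus P depends continuously on an oblique projection e with the same range.
-/
theorem starProjection_eq_of_idempotent (U : Submodule ℝ (Euc N)) (e : Euc N →L[ℝ] Euc N)
    (hmem : ∀ x, e x ∈ U) (hfix : ∀ x ∈ U, e x = x) :
    U.starProjection = e * Ring.inverse (1 + e - adjoint e) := by
  have h1 : U.starProjection * e = e := by
    ext1 x; exact Submodule.starProjection_eq_self_iff.2 (hmem x)
  have h2 : e * U.starProjection = U.starProjection := by
    ext1 x; exact hfix _ (Submodule.starProjection_apply_mem U x)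
  have h3 : U.starProjection * adjoint e = U.starProjection := by
    have h := congrArg star h2
    rw [star_mul, (isSelfAdjoint_starProjection U).star_eq] at h
    exact h
  have h4 : U.starProjection * (1 + e - adjoint e) = e := by
    rw [mul_sub, mul_add, h1, h3, mul_one]; abel
  rw [Ring.eq_mul_inverse_iff_mul_eq _ _ _ (isUnit_one_add_sub_adjoint e), h4]

/-- Conjugating the projection onto C by g gives an oblique projection onto g(C). -/
theorem starProjection_map {g : Euc N →L[ℝ] Euc N} (hg : IsUnit g) (C : Submodule ℝ (Euc N)) :
    (C.map (g : Euc N →ₗ[ℝ] Euc N)).starProjection =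
      (g * C.starProjection * Ring.inverse g) *
        Ring.inverse (1 + g * C.starProjection * Ring.inverse g -
          adjoint (g * C.starProjection * Ring.inverse g)) := by
  apply starProjection_eq_of_idempotent
  · exact fun x => Submodule.mem_map_of_mem (Submodule.starProjection_apply_mem C _)
  · rintro _ ⟨x, hx, rfl⟩
    change g (C.starProjection ((Ring.inverse g * g) x)) = g x
    rw [Ring.inverse_mul_cancel g hg]
    exact congrArg g (Submodule.starProjection_eq_self_iff.2 hx)

theorem _root_.ContinuousAt.ringInverse {Y R : Type*} [TopologicalSpace Y] [NormedRing R]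
    [HasSummableGeomSeries R] {f : Y → R} {y : Y} (hf : ContinuousAt f y) (hu : IsUnit (f y)) :
    ContinuousAt (fun y => Ring.inverse (f y)) y := by
  obtain ⟨u, hu⟩ := hu
  have h := NormedRing.inverse_continuousAt u
  rw [hu] at h
  exact ContinuousAt.comp h hf

theorem continuous_starProjection_map {Y : Type*} [TopologicalSpace Y]
    {g : Y → (Euc N →L[ℝ] Euc N)} {C : Y → Submodule ℝ (Euc N)} (hg : Continuous g)
    (hu : ∀ y, IsUnit (g y)) (hC : Continuous fun y => (C y).starProjection) :
    Continuous fun y => ((C y).map (g y : Euc N →ₗ[ℝ] Euc N)).starProjection := by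
  have h1 : Continuous fun y => g y * (C y).starProjection * Ring.inverse (g y) :=
    (hg.mul hC).mul (continuous_iff_continuousAt.2 fun y => hg.continuousAt.ringInverse (hu y))
  have h2 : Continuous fun y => adjoint (g y * (C y).starProjection * Ring.inverse (g y)) :=
    (LinearIsometryEquiv.continuous _).comp h1
  simp_rw [starProjection_map (hu _)]
  exact h1.mul (continuous_iff_continuousAt.2 fun y =>
    ((continuous_const.add h1).sub h2).continuousAt.ringInverse (isUnit_one_add_sub_adjoint _))

theorem finrank_map_of_isUnit {g : Euc N →L[ℝ] Euc N} (hg : IsUnit g) (C : Submodule ℝ (Euc N)) :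
    Module.finrank ℝ (C.map (g : Euc N →ₗ[ℝ] Euc N)) = Module.finrank ℝ C :=
  (Submodule.equivMapOfInjective _
    (ContinuousLinearMap.isUnit_iff_bijective.1 hg).1 C).finrank_eq.symm

/-! ### Planes as subspaces -/

theorem mem_iff_affLift_mem_cone (H : Plane d m) (x : Euc d) : x ∈ H.1 ↔ affLift x ∈ cone H.1 := by
  refine ⟨fun hx => Submodule.subset_span ⟨x, hx, rfl⟩, fun hx => ?_⟩
  obtain ⟨p, hp⟩ := H.2.1
  rw [cone_eq H.1 hp] at hx
  obtain ⟨_, ⟨v, hv, rfl⟩, _, hc, h⟩ := Submodule.mem_sup.1 hx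
  obtain ⟨c, rfl⟩ := Submodule.mem_span_singleton.1 hc
  -- Compare the coordinates x₀.
  have hc1 : c = 1 := by
    simpa [affLift, linLift] using congrArg (fun v : Euc (d + 1) => v 0) h
  rw [hc1, one_smul, ← eq_sub_iff_add_eq, lift_sub] at h
  have := linLift_injective d h
  rw [← sub_add_cancel x p, ← this]
  exact AffineSubspace.vadd_mem_of_mem_direction hv hp

theorem cone_injective : Function.Injective fun H : Plane d m => cone H.1 := by
  intro H H' h
  apply Subtype.ext
  ext x
  rw [mem_iff_affLift_mem_cone, mem_iff_affLift_mem_cone]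
  exact iff_of_eq (congrArg (affLift x ∈ ·) h)

theorem exists_affLift_eq {y : Euc (d + 1)} (hy : y 0 = 1) : ∃ x, affLift x = y := by
  refine ⟨WithLp.toLp 2 fun i => y i.succ, ?_⟩
  ext i
  refine Fin.cases ?_ (fun j => ?_) i <;> simp [affLift, hy]

theorem affLift_combination (x y z : Euc d) (c : ℝ) :
    c • (affLift x - affLift y) + affLift z = affLift (c • (x - y) + z) := by
  rw [lift_sub, ← map_smul, ← eq_sub_iff_add_eq, lift_sub, add_sub_cancel_right]

/-- The affine subspace cut out by a linear subspace of `ℝᵈ⁺¹` on the hyperplane `x₀ = 1`. -/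
def slice (C : Submodule ℝ (Euc (d + 1))) : AffineSubspace ℝ (Euc d) where
  carrier := {x | affLift x ∈ C}
  smul_vsub_vadd_mem' c x y z hx hy hz := by
    change affLift (c • (x - y) + z) ∈ C
    rw [← affLift_combination]
    exact C.add_mem (C.smul_mem c (C.sub_mem hx hy)) hz

theorem cone_slice {C : Submodule ℝ (Euc (d + 1))} (hC : ∃ x, affLift x ∈ C) :
    cone (slice C) = C := by
  apply le_antisymm
  · exact Submodule.span_le.2 (by rintro _ ⟨x, hx, rfl⟩; exact hx)
  · obtain ⟨p, hp⟩ := hC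
    intro y hy
    obtain ⟨x, hx⟩ := exists_affLift_eq (y := y - (y 0 - 1) • affLift p) (by simp [affLift])
    have hxC : affLift x ∈ C := by rw [hx]; exact C.sub_mem hy (C.smul_mem _ hp)
    rw [← sub_add_cancel y ((y 0 - 1) • affLift p), ← hx]
    exact Submodule.add_mem _ (Submodule.subset_span ⟨x, hxC, rfl⟩)
      (Submodule.smul_mem _ _ (Submodule.subset_span ⟨p, hp, rfl⟩))

/-- The plane cut out by a linear subspace of `ℝᵈ⁺¹` that meets the hyperplane `x₀ = 1`. -/
def Plane.ofSubmodule (C : Submodule ℝ (Euc (d + 1))) (hm : Module.finrank ℝ C = m + 1)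
    (hC : ∃ x, affLift x ∈ C) : Plane d m :=
  ⟨slice C, hC, by
    have h := finrank_cone (d := d) (m := Module.finrank ℝ (slice C).direction) ⟨slice C, hC, rfl⟩
    change Module.finrank ℝ (cone (slice C)) = _ at h
    rw [cone_slice hC] at h
    omega⟩

theorem cone_ofSubmodule (C : Submodule ℝ (Euc (d + 1))) (hm : Module.finrank ℝ C = m + 1)
    (hC : ∃ x, affLift x ∈ C) : cone (Plane.ofSubmodule C hm hC).1 = C :=
  cone_slice hC

theorem Plane.continuous_iff {Y : Type*} [TopologicalSpace Y] {f : Y → Plane d m} :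
    Continuous f ↔ Continuous fun y => (cone (f y).1).starProjection := by
  rw [continuous_induced_rng, continuous_induced_rng]
  rfl

theorem Gr.continuous_iff {Y : Type*} [TopologicalSpace Y] {f : Y → Gr N k} :
    Continuous f ↔ Continuous fun y => (f y).1.starProjection :=
  continuous_induced_rng

theorem Plane.continuous_starProjection_cone :
    Continuous fun H : Plane d m => (cone H.1).starProjection :=
  Plane.continuous_iff.1 continuous_id

theorem mem_transversals_iff {ι : Type} {A : ι → Set (Euc d)} {H : Plane d m} :
    H ∈ transversals m A ↔ ∀ i, ∃ y ∈ affLift '' A i, y ∈ cone H.1 := by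
  simp only [transversals, Set.mem_ofPred_eq, Set.exists_mem_image, ← mem_iff_affLift_mem_cone]
  exact forall_congr' fun i => ⟨fun ⟨x, h1, h2⟩ => ⟨x, h2, h1⟩, fun ⟨x, h1, h2⟩ => ⟨x, h2, h1⟩⟩

theorem continuous_affLift : Continuous (affLift : Euc d → Euc (d + 1)) := by
  have h : (affLift : Euc d → Euc (d + 1)) = fun x => linLift d x + affLift 0 := by
    ext1 x
    rw [← sub_eq_iff_eq_add, lift_sub, sub_zero]
  rw [h]
  exact (LinearMap.continuous_of_finiteDimensional _).add continuous_const

theorem convex_image_affLift {s : Set (Euc d)} (hs : Convex ℝ s) : Convex ℝ (affLift '' s) := by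
  have h : (affLift '' s) = (fun y => affLift 0 + y) '' (linLift d '' s) := by
    rw [Set.image_image]
    refine Set.image_congr fun x _ => ?_
    rw [← sub_eq_iff_eq_add', lift_sub, sub_zero]
  rw [h]
  exact (hs.linear_image (linLift d)).translate _

theorem exists_le_finrank_eq {V : Type*} [AddCommGroup V] [Module ℝ V] [FiniteDimensional ℝ V]
    (W : Submodule ℝ V) {r : ℕ} (h1 : Module.finrank ℝ W ≤ r) (h2 : r ≤ Module.finrank ℝ V) :
    ∃ U : Submodule ℝ V, W ≤ U ∧ Module.finrank ℝ U = r := by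
  induction r, h1 using Nat.le_induction with
  | base => exact ⟨W, le_rfl, rfl⟩
  | succ r _ ih =>
    obtain ⟨U, hWU, hU⟩ := ih (by omega)
    have hne : U ≠ ⊤ := by rintro rfl; rw [finrank_top] at hU; omega
    obtain ⟨x, -, hx⟩ := SetLike.exists_of_lt hne.lt_top
    have hx0 : x ≠ 0 := by rintro rfl; exact hx U.zero_mem
    have h := Submodule.finrank_sup_add_finrank_inf_eq U (Submodule.span ℝ {x})
    have hd : U ⊓ Submodule.span ℝ {x} = ⊥ :=
      disjoint_iff.1 ((Submodule.disjoint_span_singleton' hx0).2 hx)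
    rw [hd, finrank_bot, finrank_span_singleton hx0, hU] at h
    exact ⟨U ⊔ Submodule.span ℝ {x}, hWU.trans le_sup_left, h⟩

theorem linearIndependent_of_no_transversal {ρ : ℕ} (hρ : ρ ≤ d) {A : Fin (ρ + 2) → Set (Euc d)}
    (hno : ¬ ∃ H : Plane d ρ, H ∈ transversals ρ A) {v : Fin (ρ + 2) → Euc (d + 1)}
    (hv : ∀ i, v i ∈ affLift '' A i) : LinearIndependent ℝ v := by
  by_contra hdep
  rw [linearIndependent_iff_card_le_finrank_span, Fintype.card_fin, not_le, Set.finrank] at hdep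
  -- The span may be too small, so it is enlarged to the dimension of the cone of a ρ-plane.
  obtain ⟨C, hC, hr⟩ := exists_le_finrank_eq (Submodule.span ℝ (Set.range v)) (r := ρ + 1)
    (by omega) (by rw [finrank_euclideanSpace_fin]; omega)
  have hmem : ∀ i, v i ∈ C := fun i => hC (Submodule.subset_span ⟨i, rfl⟩)
  have hx : ∃ x, affLift x ∈ C := by
    obtain ⟨x, -, hx⟩ := hv 0
    exact ⟨x, hx ▸ hmem 0⟩
  refine hno ⟨Plane.ofSubmodule C hr hx, mem_transversals_iff.2 fun i => ⟨v i, hv i, ?_⟩⟩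
  rw [cone_ofSubmodule]
  exact hmem i

/-! ### Transport along a segment of tuples -/

/-- Neither tuple need be continuous: a bounded left inverse and a vanishing displacement force the
slide to tend to 1. -/
theorem continuousAt_slide_of_eq {Y : Type*} [TopologicalSpace Y] {v w : Y → Fin k → Euc N}
    {y : Y} {M : ℝ} (hM : ∀ y, ‖leftInv (v y)‖ ≤ M)
    (hvw : Tendsto (fun y => ‖w y - v y‖) (𝓝 y) (𝓝 0)) (hy : w y = v y) :
    ContinuousAt (fun y => slide (v y) (w y)) y := by
  rw [ContinuousAt, hy, slide_self, tendsto_iff_norm_sub_tendsto_zero]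
  refine squeeze_zero (fun _ => norm_nonneg _) (fun z => (norm_slide_sub_one_le _ _).trans
    (mul_le_mul_of_nonneg_left (hM z) (by positivity))) ?_
  simpa using (hvw.const_mul ‖tupleMap N k‖).mul_const M

/-- The composition of `j` slides that moves the tuple `v` along the segment towards `κ`, each
time by the fraction `h` of the segment. -/
def transport (κ v : Fin k → Euc N) (h : ℝ) : ℕ → (Euc N →L[ℝ] Euc N)
  | 0 => 1
  | j + 1 => slide (AffineMap.lineMap v κ (j * h)) (AffineMap.lineMap v κ ((j + 1) * h)) *
      transport κ v h j

theorem transport_self (κ : Fin k → Euc N) (h : ℝ) (j : ℕ) : transport κ κ h j = 1 := by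
  induction j with
  | zero => rfl
  | succ j ih => simp [transport, ih, slide_self]

theorem transport_zero (κ v : Fin k → Euc N) (j : ℕ) : transport κ v 0 j = 1 := by
  induction j with
  | zero => rfl
  | succ j ih => simp [transport, ih, slide_self]

theorem transport_apply {P : Set (Fin k → Euc N)} (hP : Convex ℝ P)
    (hi : ∀ v ∈ P, LinearIndependent ℝ v) {κ v : Fin k → Euc N} (hκ : κ ∈ P) (hv : v ∈ P)
    {h : ℝ} (h0 : 0 ≤ h) (j : ℕ) (hj : j * h ≤ 1) (i : Fin k) :
    transport κ v h j (v i) = AffineMap.lineMap v κ (j * h) i := by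
  induction j with
  | zero => simp [transport]
  | succ j ih =>
    push_cast at hj ⊢
    have hj' : j * h ≤ 1 := by linarith
    change slide _ _ (transport κ v h j (v i)) = _
    rw [ih hj']
    exact slide_apply (hi _ (hP.lineMap_mem hv hκ ⟨by positivity, hj'⟩)) _ i

theorem lineMap_succ_sub (κ v : Fin k → Euc N) (a h : ℝ) :
    AffineMap.lineMap v κ ((a + 1) * h) - AffineMap.lineMap v κ (a * h) = h • (κ - v) := by
  simp only [AffineMap.lineMap_apply_module']
  module

theorem isUnit_transport {P : Set (Fin k → Euc N)} (hP : Convex ℝ P) {M R : ℝ}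
    (hM : ∀ v ∈ P, ‖leftInv v‖ ≤ M) {κ v : Fin k → Euc N} (hκ : κ ∈ P) (hv : v ∈ P)
    (hR : ‖κ - v‖ ≤ R) {h : ℝ} (h0 : 0 ≤ h) (hs : ‖tupleMap N k‖ * (h * R) * M < 1)
    (j : ℕ) (hj : j * h ≤ 1) : IsUnit (transport κ v h j) := by
  induction j with
  | zero => exact isUnit_one
  | succ j ih =>
    push_cast at hj
    have hj' : j * h ≤ 1 := by linarith
    refine IsUnit.mul (isUnit_slide (lt_of_le_of_lt ?_ hs)) (ih hj')
    rw [lineMap_succ_sub, norm_smul, Real.norm_of_nonneg h0]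
    have := hM _ (hP.lineMap_mem hv hκ ⟨by positivity, hj'⟩)
    have hR0 : 0 ≤ R := (norm_nonneg _).trans hR
    gcongr

theorem continuousAt_transport {P : Set (Fin k → Euc N)} (hP : Convex ℝ P)
    (hi : ∀ v ∈ P, LinearIndependent ℝ v) {M R : ℝ} (hM : ∀ v ∈ P, ‖leftInv v‖ ≤ M)
    {κ : Fin k → Euc N} (hκ : κ ∈ P) (hR : ∀ v ∈ P, ‖κ - v‖ ≤ R)
    {Y : Type*} [TopologicalSpace Y] {v : Y → Fin k → Euc N} (hv : ∀ y, v y ∈ P)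
    {h : Y → ℝ} (h0 : ∀ y, 0 ≤ h y) {y : Y} (hh : ContinuousAt h y)
    (hy : ContinuousAt v y ∨ h y = 0) (j : ℕ) (hj : ∀ y, j * h y ≤ 1) :
    ContinuousAt (fun y => transport κ (v y) (h y) j) y := by
  induction j with
  | zero => exact continuousAt_const
  | succ j ih =>
    push_cast at hj
    have hj' : ∀ y, j * h y ≤ 1 := fun y => by linarith [hj y, h0 y]
    have hmem : ∀ y, AffineMap.lineMap (v y) κ (j * h y) ∈ P := fun y =>
      hP.lineMap_mem (hv y) hκ ⟨mul_nonneg (by positivity) (h0 y), hj' y⟩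
    refine ContinuousAt.mul ?_ (ih hj')
    -- Where `v` may jump, `h` vanishes, so every displacement `h • (κ - v)` tends to 0.
    rcases hy with hy | hy
    · have hl : ∀ a : ℝ, ContinuousAt
          (fun z => (AffineMap.lineMap (v z) κ (a * h z) : Fin k → Euc N)) y := fun a => by
        simp only [AffineMap.lineMap_apply_module']
        exact ((continuousAt_const.mul hh).smul (continuousAt_const.sub hy)).add hy
      exact ContinuousAt.slide (hl j) (hl (j + 1)) (hi _ (hmem y))
    · apply continuousAt_slide_of_eq (M := M) (fun y => hM _ (hmem y))
      · simp_rw [lineMap_succ_sub]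
        have hlim : Tendsto (fun z => h z * R) (𝓝 y) (𝓝 0) := by
          have := hh.tendsto.mul_const R
          rwa [hy, zero_mul] at this
        refine squeeze_zero (fun _ => norm_nonneg _) (fun z => ?_) hlim
        rw [norm_smul, Real.norm_of_nonneg (h0 z)]
        exact mul_le_mul_of_nonneg_left (hR _ (hv z)) (h0 z)
      · simp [hy]

/-! ### Penalized nearest points -/

/-- By compactness it suffices to identify cluster points, and passing to the limit in the
minimality inequalities makes each of them a minimizer. -/
theorem continuousAt_of_isMinOn {Z X : Type*} [TopologicalSpace Z] [TopologicalSpace X]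
    {K : Set X} (hK : IsCompact K) {f : Z → X → ℝ} (hf : Continuous (Function.uncurry f))
    {v : Z → X} (hv : ∀ z, v z ∈ K) (hmin : ∀ z, IsMinOn (f z) K (v z)) {z : Z}
    (huniq : ∀ y ∈ K, IsMinOn (f z) K y → y = v z) : ContinuousAt v z := by
  refine hK.tendsto_nhds_of_unique_mapClusterPt (Eventually.of_forall hv) fun y hy hcl => ?_
  obtain ⟨U, hU, hvU⟩ := mapClusterPt_iff_ultrafilter.1 hcl
  refine huniq y hy fun x hx => ?_
  have hid : Tendsto (fun z : Z => z) U (𝓝 z) := hU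
  have h1 : Tendsto (fun z => f z (v z)) U (𝓝 (f z y)) :=
    (hf.tendsto (z, y)).comp (hid.prodMk_nhds hvU)
  have h2 : Tendsto (fun z => f z x) U (𝓝 (f z x)) :=
    (hf.tendsto (z, x)).comp (hid.prodMk_nhds tendsto_const_nhds)
  exact le_of_tendsto_of_tendsto' h1 h2 fun z => hmin z hx

/-- A weighted sum of the squared distances of `x` to the point `a` and to the fixed space of
`p`. -/
def penalty (t l : ℝ) (a : Euc N) (p : Euc N →L[ℝ] Euc N) (x : Euc N) : ℝ :=
  t * ‖x - a‖ ^ 2 + l * ‖x - p x‖ ^ 2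

theorem norm_midpoint_sq (x y : Euc N) :
    ‖midpoint ℝ x y‖ ^ 2 = (‖x‖ ^ 2 + ‖y‖ ^ 2) / 2 - ‖x - y‖ ^ 2 / 4 := by
  have h := parallelogram_law_with_norm ℝ x y
  rw [midpoint_eq_smul_add, norm_smul, mul_pow]
  norm_num
  linarith

theorem penalty_midpoint_le {t l : ℝ} (hl : 0 ≤ l) (a : Euc N)
    (p : Euc N →L[ℝ] Euc N) (x y : Euc N) :
    penalty t l a p (midpoint ℝ x y) ≤
      (penalty t l a p x + penalty t l a p y) / 2 - t * ‖x - y‖ ^ 2 / 4 := by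
  have h1 : midpoint ℝ x y - a = midpoint ℝ (x - a) (y - a) := by
    simp only [midpoint_eq_smul_add, invOf_eq_inv]; module
  have h2 : midpoint ℝ x y - p (midpoint ℝ x y) = midpoint ℝ (x - p x) (y - p y) := by
    simp only [midpoint_eq_smul_add, invOf_eq_inv, map_smul, map_add]; module
  rw [penalty, h1, h2, norm_midpoint_sq, norm_midpoint_sq, sub_sub_sub_cancel_right]
  have : 0 ≤ l * ‖x - p x - (y - p y)‖ ^ 2 := by positivity
  unfold penalty
  linarith

/-- Two distinct minimizers would be beaten by their midpoint; the strict convexity comes from the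
term with weight t. -/
theorem eq_of_isMinOn_penalty {t l : ℝ} (ht : 0 < t) (hl : 0 ≤ l) {a : Euc N}
    {p : Euc N →L[ℝ] Euc N} {K : Set (Euc N)} (hK : Convex ℝ K) {x y : Euc N} (hx : x ∈ K)
    (hy : y ∈ K) (hxm : IsMinOn (penalty t l a p) K x) (hym : IsMinOn (penalty t l a p) K y) :
    x = y := by
  have h1 := penalty_midpoint_le (t := t) hl a p x y
  have h2 : penalty t l a p x ≤ _ := hxm (hK.midpoint_mem hx hy)
  have h3 : penalty t l a p y ≤ _ := hym (hK.midpoint_mem hx hy)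
  have h4 : ‖x - y‖ ^ 2 ≤ 0 := by
    by_contra! h
    have := mul_pos ht h
    linarith
  rw [← sub_eq_zero, ← norm_eq_zero]
  exact pow_eq_zero_iff two_ne_zero |>.1 (le_antisymm h4 (sq_nonneg _))

/-! ### The deformation -/

theorem continuous_penalty {Y : Type*} [TopologicalSpace Y] {p : Y → (Euc N →L[ℝ] Euc N)}
    (hp : Continuous p) (l : ℝ) (a : Euc N) :
    Continuous (Function.uncurry fun (z : unitInterval × Y) x => penalty z.1 l a (p z.2) x) := by
  have h1 : Continuous fun w : (unitInterval × Y) × Euc N => p w.1.2 w.2 :=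
    (hp.comp (continuous_snd.comp continuous_fst)).clm_apply continuous_snd
  unfold penalty Function.uncurry
  fun_prop

/-- Nearest points `v z i ∈ K i` to the subspaces `C y`, penalized by the distance to `κ i`. -/
theorem exists_penalized_nearest {Y : Type*} [TopologicalSpace Y] {C : Y → Submodule ℝ (Euc N)}
    (hC : Continuous fun y => (C y).starProjection) {K : Fin k → Set (Euc N)}
    (hconv : ∀ i, Convex ℝ (K i)) (hcomp : ∀ i, IsCompact (K i))
    {κ : Fin k → Euc N} (hκ : κ ∈ Set.pi Set.univ K) (hmeet : ∀ y i, ∃ x ∈ K i, x ∈ C y)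
    {R ε : ℝ} (hR0 : 0 < R) (hR : ∀ v ∈ Set.pi Set.univ K, ‖κ - v‖ ≤ R) (hε : 0 < ε) :
    ∃ v : unitInterval × Y → Fin k → Euc N, (∀ z, v z ∈ Set.pi Set.univ K) ∧
      (∀ z, 0 < (z.1 : ℝ) → ContinuousAt v z) ∧
      (∀ z i, ‖(C z.2).starProjection (v z i) - v z i‖ ≤ ε * √z.1) ∧
      (∀ z, 0 < (z.1 : ℝ) → (∀ i, κ i ∈ C z.2) → v z = κ) := by
  have hl : 0 ≤ (R / ε) ^ 2 := sq_nonneg _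
  have hpen := fun i => continuous_penalty hC ((R / ε) ^ 2) (κ i)
  have hex : ∀ (z : unitInterval × Y) i, ∃ x ∈ K i,
      IsMinOn (penalty z.1 ((R / ε) ^ 2) (κ i) (C z.2).starProjection) (K i) x := fun z i =>
    (hcomp i).exists_isMinOn ⟨κ i, hκ i trivial⟩
      ((hpen i).comp (Continuous.prodMk_right z)).continuousOn
  choose v hvK hvmin using hex
  refine ⟨v, fun z i _ => hvK z i, fun z hz => ?_, fun z i => ?_, fun z hz hzκ => ?_⟩
  · exact continuousAt_pi.2 fun i => continuousAt_of_isMinOn (hcomp i) (hpen i)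
      (fun z => hvK z i) (fun z => hvmin z i) fun x hx hxm =>
        eq_of_isMinOn_penalty hz hl (hconv i) hx (hvK z i) hxm (hvmin z i)
  · choose x hxK hxC using hmeet z.2
    -- A point of `K i ∩ C` costs at most tR², so the weight (R/ε)² bounds the distance of the
    -- minimizer to `C` by ε√t.
    have h1 : penalty _ _ _ _ (v z i) ≤ _ := hvmin z i (hxK i)
    have h2 : ‖x i - κ i‖ ≤ R := by
      rw [norm_sub_rev]
      exact (norm_le_pi_norm (κ - x) i).trans (hR x fun i _ => hxK i)
    have h3 : (C z.2).starProjection (x i) = x i :=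
      Submodule.starProjection_eq_self_iff.2 (hxC i)
    have ht : 0 ≤ (z.1 : ℝ) := z.1.2.1
    have h4 : (R / ε) ^ 2 * ‖v z i - (C z.2).starProjection (v z i)‖ ^ 2 ≤ z.1 * R ^ 2 := by
      simp only [penalty, h3, sub_self, norm_zero] at h1
      have h5 : (z.1 : ℝ) * ‖x i - κ i‖ ^ 2 ≤ z.1 * R ^ 2 := by gcongr
      have h6 : 0 ≤ (z.1 : ℝ) * ‖v z i - κ i‖ ^ 2 := by positivity
      linarith
    rw [norm_sub_rev]
    apply le_of_sq_le_sq _ (by positivity)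
    rw [mul_pow, Real.sq_sqrt ht]
    rw [div_pow, div_mul_eq_mul_div, div_le_iff₀ (by positivity)] at h4
    have : 0 < R ^ 2 := by positivity
    nlinarith
  · funext i
    -- Here `κ i` itself has penalty 0.
    have h1 : penalty _ _ _ _ (v z i) ≤ _ := hvmin z i (hκ i trivial)
    have h3 : (C z.2).starProjection (κ i) = κ i := Submodule.starProjection_eq_self_iff.2 (hzκ i)
    simp only [penalty, h3, sub_self, norm_zero] at h1
    have h4 : 0 ≤ (R / ε) ^ 2 * ‖v z i - (C z.2).starProjection (v z i)‖ ^ 2 := by positivity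
    have h5 : ‖v z i - κ i‖ ^ 2 ≤ 0 := by
      by_contra! h
      have := mul_pos hz h
      linarith
    rw [← sub_eq_zero, ← norm_eq_zero]
    exact pow_eq_zero_iff two_ne_zero |>.1 (le_antisymm h5 (sq_nonneg _))

theorem exists_deformation {Y : Type*} [TopologicalSpace Y] {C : Y → Submodule ℝ (Euc N)}
    (hC : Continuous fun y => (C y).starProjection) {K : Fin k → Set (Euc N)}
    (hconv : ∀ i, Convex ℝ (K i)) (hcomp : ∀ i, IsCompact (K i))
    (hind : ∀ v ∈ Set.pi Set.univ K, LinearIndependent ℝ v)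
    {κ : Fin k → Euc N} (hκ : κ ∈ Set.pi Set.univ K) (hmeet : ∀ y i, ∃ x ∈ K i, x ∈ C y) :
    ∃ g : unitInterval × Y → (Euc N →L[ℝ] Euc N), Continuous g ∧ (∀ z, IsUnit (g z)) ∧
      (∀ y, g (0, y) = 1) ∧
      (∀ y i, κ i ∈ (C y).map (g (1, y) : Euc N →ₗ[ℝ] Euc N)) ∧
      (∀ z i, ∃ x ∈ K i, x ∈ (C z.2).map (g z : Euc N →ₗ[ℝ] Euc N)) ∧
      (∀ z, (∀ i, κ i ∈ C z.2) → g z = 1) := by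
  set P := Set.pi Set.univ K with hP
  have hPconv : Convex ℝ P := convex_pi fun i _ => hconv i
  have hPcomp : IsCompact P := isCompact_univ_pi hcomp
  obtain ⟨M, hM0, hM⟩ := exists_norm_leftInv_le hPcomp hind
  obtain ⟨R, hR0, hR⟩ : ∃ R : ℝ, 0 < R ∧ ∀ v ∈ P, ‖κ - v‖ ≤ R := by
    obtain ⟨R, hR⟩ := hPcomp.exists_bound_of_continuousOn (f := fun v => κ - v)
      (continuous_const.sub continuous_id).continuousOn
    exact ⟨max R 1, by positivity, fun v hv => (hR v hv).trans (le_max_left _ _)⟩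
  set c := ‖tupleMap N k‖ with hc
  have hc0 : 0 ≤ c := norm_nonneg (tupleMap N k)
  -- One slide along the whole segment might be singular; each of n equal steps is close enough to 1
  -- to be invertible.
  obtain ⟨n, hn⟩ := exists_nat_gt (c * R * M)
  have hn0 : (0 : ℝ) < n := lt_of_le_of_lt (by positivity) hn
  obtain ⟨ε, hε0, hε⟩ : ∃ ε : ℝ, 0 < ε ∧ c * ε * M < 1 := by
    refine ⟨1 / (c * M + 1), by positivity, ?_⟩
    rw [mul_one_div, div_mul_eq_mul_div, div_lt_one (by positivity)]
    linarith
  obtain ⟨v, hv, hvcont, hvdist, hvκ⟩ :=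
    exists_penalized_nearest hC hconv hcomp hκ hmeet hR0 hR hε0
  let w : unitInterval × Y → Fin k → Euc N := fun z i => (C z.2).starProjection (v z i)
  have hwv : ∀ z, ‖w z - v z‖ ≤ ε * √z.1 := fun z =>
    (pi_norm_le_iff_of_nonneg (by positivity)).2 (hvdist z)
  have hw0 : ∀ z : unitInterval × Y, (z.1 : ℝ) = 0 → w z = v z := fun z hz => by
    have h := hwv z
    rw [hz, Real.sqrt_zero, mul_zero] at h
    exact sub_eq_zero.1 (norm_le_zero_iff.1 h)
  have hunit : ∀ z, IsUnit (slide (v z) (w z)) := fun z => by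
    refine isUnit_slide (lt_of_le_of_lt ?_ hε)
    have h1 : ‖w z - v z‖ ≤ ε := (hwv z).trans
      (mul_le_of_le_one_right hε0.le (Real.sqrt_le_one.2 z.1.2.2))
    have h2 := hM _ (hv z)
    gcongr
  let h : unitInterval × Y → ℝ := fun z => z.1 / n
  have hh : Continuous h := by fun_prop
  have hh0 : ∀ z, 0 ≤ h z := fun z => div_nonneg z.1.2.1 hn0.le
  have hnh : ∀ z, n * h z = z.1 := fun z => mul_div_cancel₀ _ hn0.ne'
  have hnh1 : ∀ z, n * h z ≤ 1 := fun z => (hnh z).trans_le z.1.2.2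
  have hhs : ∀ z, c * (h z * R) * M < 1 := fun z => by
    have h1 : h z ≤ 1 / n := div_le_div_of_nonneg_right z.1.2.2 hn0.le
    calc c * (h z * R) * M ≤ c * (1 / n * R) * M := by gcongr
      _ = c * R * M / n := by ring
      _ < 1 := (div_lt_one hn0).2 hn
  -- At time 0 only the estimate ε√t is available; at positive times `v` and `w` are continuous.
  have hslide : Continuous fun z => slide (v z) (w z) := continuous_iff_continuousAt.2 fun z => by
    rcases z.1.2.1.eq_or_lt with hz | hz
    · refine continuousAt_slide_of_eq (M := M) (fun z => hM _ (hv z)) ?_ (hw0 z hz.symm)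
      refine squeeze_zero (fun _ => norm_nonneg _) hwv ?_
      have : Continuous fun z : unitInterval × Y => ε * √(z.1 : ℝ) := by fun_prop
      simpa [← hz] using this.tendsto z
    · have hvz := hvcont z hz
      refine ContinuousAt.slide hvz (continuousAt_pi.2 fun i => ?_) (hind _ (hv z))
      exact ((hC.comp continuous_snd).continuousAt).clm_apply (continuousAt_pi.1 hvz i)
  -- The right factor takes `w`, which lies in `C`, to `v`; the left one makes n steps of size t/n
  -- towards `κ`.
  let g : unitInterval × Y → (Euc N →L[ℝ] Euc N) := fun z =>
    transport κ (v z) (h z) n * Ring.inverse (slide (v z) (w z))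
  have hgw : ∀ z i, g z (w z i) = AffineMap.lineMap (v z) κ (z.1 : ℝ) i := fun z i => by
    have h1 : Ring.inverse (slide (v z) (w z)) (w z i) = v z i := by
      rw [← slide_apply (hind _ (hv z)) (w z) i]
      exact congrArg (fun f => f (v z i)) (Ring.inverse_mul_cancel _ (hunit z))
    change transport κ (v z) (h z) n (Ring.inverse (slide (v z) (w z)) (w z i)) = _
    rw [h1, transport_apply hPconv hind hκ (hv z) (hh0 z) n (hnh1 z), hnh]
  have hmem : ∀ z i, AffineMap.lineMap (v z) κ (z.1 : ℝ) i ∈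
      (C z.2).map (g z : Euc N →ₗ[ℝ] Euc N) := fun z i =>
    ⟨w z i, Submodule.starProjection_apply_mem _ _, hgw z i⟩
  have hg0 : ∀ z : unitInterval × Y, (z.1 : ℝ) = 0 → g z = 1 := fun z hz => by
    have : h z = 0 := by simp [h, hz]
    simp only [g, this, transport_zero, hw0 z hz, slide_self, Ring.inverse_one, mul_one]
  refine ⟨g, ?_, fun z => ?_, fun y => hg0 _ rfl, fun y i => ?_, fun z i => ?_, fun z hz => ?_⟩
  · refine continuous_iff_continuousAt.2 fun z => ContinuousAt.mul ?_
      (hslide.continuousAt.ringInverse (hunit z))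
    refine continuousAt_transport hPconv hind hM hκ hR hv hh0 hh.continuousAt ?_ n hnh1
    rcases z.1.2.1.eq_or_lt with hz | hz
    · exact Or.inr (by simp [h, ← hz])
    · exact Or.inl (hvcont z hz)
  · exact (isUnit_transport hPconv hM hκ (hv z) (hR _ (hv z)) (hh0 z) (hhs z) n (hnh1 z)).mul
      (hunit z).ringInverse
  · simpa using hmem (1, y) i
  · exact ⟨_, hPconv.lineMap_mem (hv z) hκ z.1.2 i trivial, hmem z i⟩
  · rcases z.1.2.1.eq_or_lt with h0 | h0
    · exact hg0 z h0.symm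
    · have hwκ : w z = κ := by
        funext i
        change (C z.2).starProjection (v z i) = κ i
        rw [hvκ z h0 hz]
        exact Submodule.starProjection_eq_self_iff.2 (hz i)
      simp only [g, hwκ, hvκ z h0 hz, transport_self, slide_self, Ring.inverse_one, mul_one]

/-! ### Subspaces containing a fixed subspace -/

theorem exists_isometry_onto_orthogonal (V : Submodule ℝ (Euc N))
    (h : Module.finrank ℝ V + r = N) :
    ∃ J : Euc r →ₗᵢ[ℝ] Euc N, LinearMap.range J.toLinearMap = Vᗮ := by
  have h1 := V.finrank_add_finrank_orthogonal
  rw [finrank_euclideanSpace_fin] at h1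
  have h2 : Module.finrank ℝ Vᗮ = r := by omega
  let e : Euc r ≃ₗᵢ[ℝ] Vᗮ := ((stdOrthonormalBasis ℝ Vᗮ).reindex (finCongr h2)).repr.symm
  refine ⟨Vᗮ.subtypeₗᵢ.comp e.toLinearIsometry, ?_⟩
  ext x
  constructor
  · rintro ⟨y, rfl⟩
    exact (e y).2
  · exact fun hx => ⟨e.symm ⟨x, hx⟩, by simp⟩

section

variable {V : Submodule ℝ (Euc N)} {J : Euc r →ₗᵢ[ℝ] Euc N}

theorem apply_mem_orthogonal (hJ : LinearMap.range J.toLinearMap = Vᗮ) (x : Euc r) : J x ∈ Vᗮ :=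
  hJ ▸ LinearMap.mem_range_self J.toLinearMap x

theorem adjoint_isometry_apply (x : Euc r) :
    adjoint J.toContinuousLinearMap (J x) = x := by
  refine ext_inner_right ℝ fun y => ?_
  rw [adjoint_inner_left]
  exact J.inner_map_map x y

theorem isometry_adjoint_apply (hJ : LinearMap.range J.toLinearMap = Vᗮ) {x : Euc N}
    (hx : x ∈ Vᗮ) : J (adjoint J.toContinuousLinearMap x) = x := by
  rw [← hJ] at hx
  obtain ⟨y, rfl⟩ := hx
  exact congrArg J (adjoint_isometry_apply y)

theorem adjoint_isometry_apply_eq_zero (hJ : LinearMap.range J.toLinearMap = Vᗮ) {x : Euc N}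
    (hx : x ∈ V) : adjoint J.toContinuousLinearMap x = 0 := by
  refine ext_inner_right ℝ fun y => ?_
  rw [adjoint_inner_left, inner_zero_left]
  exact apply_mem_orthogonal hJ y x hx

/-- The summands V and J(U) are orthogonal, so their projections add. With `starProjection_comap`,
this yields continuity of the Grassmannian correspondence in both directions. -/
theorem starProjection_sup_map (hJ : LinearMap.range J.toLinearMap = Vᗮ)
    (U : Submodule ℝ (Euc r)) :
    (V ⊔ U.map J.toLinearMap).starProjection = V.starProjection +
      J.toContinuousLinearMap ∘L U.starProjection ∘L adjoint J.toContinuousLinearMap := by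
  ext1 x
  set J' := adjoint J.toContinuousLinearMap with hJ'
  change _ = V.starProjection x + J (U.starProjection (J' x))
  have hx : x - V.starProjection x = J (J' x) := by
    rw [← isometry_adjoint_apply hJ (V.sub_starProjection_mem_orthogonal x), ← hJ', map_sub,
      adjoint_isometry_apply_eq_zero hJ (V.starProjection_apply_mem x), sub_zero]
  apply Submodule.eq_starProjection_of_mem_orthogonal
  · exact Submodule.add_mem_sup (V.starProjection_apply_mem x)
      (Submodule.mem_map_of_mem (U.starProjection_apply_mem _))
  -- The residual is J applied to a vector orthogonal to U, so it is orthogonal to both V and J(U).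
  · rw [← sub_sub, hx, ← map_sub, ← Submodule.inf_orthogonal]
    refine ⟨apply_mem_orthogonal hJ _, ?_⟩
    rintro _ ⟨u, hu, rfl⟩
    exact (J.inner_map_map _ _).trans (U.sub_starProjection_mem_orthogonal _ u hu)

theorem starProjection_comap (hJ : LinearMap.range J.toLinearMap = Vᗮ)
    {C : Submodule ℝ (Euc N)} (hC : V ≤ C) :
    (C.comap J.toLinearMap).starProjection =
      adjoint J.toContinuousLinearMap ∘L C.starProjection ∘L J.toContinuousLinearMap := by
  ext1 x
  change _ = adjoint J.toContinuousLinearMap (C.starProjection (J x))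
  apply Submodule.eq_starProjection_of_mem_of_inner_eq_zero
  · change J _ ∈ C
    rw [isometry_adjoint_apply hJ]
    · exact C.starProjection_apply_mem _
    · intro v hv
      rw [← Submodule.inner_starProjection_left_eq_right,
        Submodule.starProjection_eq_self_iff.2 (hC hv)]
      exact apply_mem_orthogonal hJ x v hv
  · intro w hw
    rw [inner_sub_left, adjoint_inner_left, ← J.inner_map_map x w]
    change inner ℝ (J x) (J w) - inner ℝ (C.starProjection (J x)) (J w) = 0
    rw [← inner_sub_left]
    exact C.starProjection_inner_eq_zero _ _ hw

theorem comap_sup_map (hJ : LinearMap.range J.toLinearMap = Vᗮ) (U : Submodule ℝ (Euc r)) :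
    (V ⊔ U.map J.toLinearMap).comap J.toLinearMap = U := by
  apply le_antisymm
  · intro x hx
    obtain ⟨v, hv, _, ⟨u, hu, rfl⟩, h⟩ := Submodule.mem_sup.1 hx
    have h1 := congrArg (adjoint J.toContinuousLinearMap) h
    rw [map_add, adjoint_isometry_apply_eq_zero hJ hv, zero_add] at h1
    rw [← adjoint_isometry_apply (J := J) x]
    exact h1 ▸ (adjoint_isometry_apply (J := J) u).symm ▸ hu
  · exact Submodule.map_le_iff_le_comap.1 le_sup_right

theorem sup_map_comap (hJ : LinearMap.range J.toLinearMap = Vᗮ) {C : Submodule ℝ (Euc N)}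
    (hC : V ≤ C) : V ⊔ (C.comap J.toLinearMap).map J.toLinearMap = C := by
  rw [Submodule.map_comap_eq, hJ]
  exact Submodule.sup_orthogonal_inf_of_hasOrthogonalProjection hC

theorem finrank_sup_map (hJ : LinearMap.range J.toLinearMap = Vᗮ) (U : Submodule ℝ (Euc r)) :
    Module.finrank ℝ ↥(V ⊔ U.map J.toLinearMap) = Module.finrank ℝ V + Module.finrank ℝ U := by
  have h := Submodule.finrank_sup_add_finrank_inf_eq V (U.map J.toLinearMap)
  have hle : U.map J.toLinearMap ≤ Vᗮ := hJ ▸ LinearMap.map_le_range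
  have hd : V ⊓ U.map J.toLinearMap = ⊥ :=
    disjoint_iff.1 (V.orthogonal_disjoint.mono_right hle)
  rwa [hd, finrank_bot, add_zero,
    ← (Submodule.equivMapOfInjective _ J.injective U).finrank_eq] at h

end

theorem span_le_cone_iff {α : Fin k → Euc d} {H : Plane d m} :
    Submodule.span ℝ (Set.range fun i => affLift (α i)) ≤ cone H.1 ↔
      H ∈ transversals m fun i => {α i} := by
  simp [Submodule.span_le, Set.range_subset_iff, mem_transversals_iff]

/-- With V the span of the lifted points and J an isometry of ℝʳ onto Vᗮ, the inverse maps are C ↦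
J⁻¹(C) and U ↦ V ⊕ J(U). -/
theorem nonempty_homeomorph_transversals_singleton {α : Fin (k + 1) → Euc d}
    (hα : LinearIndependent ℝ fun i => affLift (α i)) (hr : k + r = d) {q : ℕ} (hq : k + q = m) :
    Nonempty (transversals m (fun i => {α i}) ≃ₜ Gr r q) := by
  set V := Submodule.span ℝ (Set.range fun i => affLift (α i)) with hVdef
  have hV : Module.finrank ℝ V = k + 1 := by
    rw [hVdef, finrank_span_eq_card hα, Fintype.card_fin]
  obtain ⟨J, hJ⟩ := exists_isometry_onto_orthogonal (r := r) V (by omega)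
  have hle : ∀ H : transversals m (fun i => {α i}), V ≤ cone H.1.1 := fun H =>
    span_le_cone_iff.2 H.2
  have hx : ∀ U : Gr r q, ∃ x, affLift x ∈ V ⊔ U.1.map J.toLinearMap := fun U =>
    ⟨α 0, le_sup_left (a := V) (Submodule.subset_span ⟨0, rfl⟩)⟩
  have hfin : ∀ U : Gr r q, Module.finrank ℝ ↥(V ⊔ U.1.map J.toLinearMap) = m + 1 := fun U => by
    have := U.2
    rw [finrank_sup_map hJ, hV]
    omega
  refine ⟨{
    toFun := fun H => ⟨(cone H.1.1).comap J.toLinearMap, ?_⟩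
    invFun := fun U => ⟨Plane.ofSubmodule (V ⊔ U.1.map J.toLinearMap) (hfin U) (hx U), ?_⟩
    left_inv := fun H => ?_
    right_inv := fun U => ?_
    continuous_toFun := ?_
    continuous_invFun := ?_ }⟩
  · have h := finrank_sup_map hJ ((cone H.1.1).comap J.toLinearMap)
    rw [sup_map_comap hJ (hle H), finrank_cone, hV] at h
    omega
  · rw [← span_le_cone_iff, cone_ofSubmodule]
    exact le_sup_left
  · apply Subtype.ext
    apply cone_injective
    exact (cone_ofSubmodule _ (hfin _) (hx _)).trans (sup_map_comap hJ (hle H))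
  · apply Subtype.ext
    exact (congrArg _ (cone_ofSubmodule _ (hfin U) (hx U))).trans (comap_sup_map hJ U.1)
  · refine Gr.continuous_iff.2 ?_
    change Continuous fun H : transversals m (fun i => {α i}) =>
      ((cone H.1.1).comap J.toLinearMap).starProjection
    simp_rw [starProjection_comap hJ (hle _)]
    exact continuous_const.clm_comp
      ((Plane.continuous_starProjection_cone.comp continuous_subtype_val).clm_comp
        continuous_const)
  · refine Continuous.subtype_mk (Plane.continuous_iff.2 ?_) _
    simp_rw [cone_ofSubmodule, starProjection_sup_map hJ]
    exact continuous_const.add (continuous_const.clm_comp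
      ((Gr.continuous_iff.1 continuous_id).clm_comp continuous_const))

instance (r : ℕ) : Unique (Gr r 0) where
  default := ⟨⊥, finrank_bot ℝ _⟩
  uniq U := Subtype.ext (Submodule.finrank_eq_zero.1 U.2)

/-! ### The deformation retraction -/

theorem isHomotopyEquiv_of_deformation {X : Type} [TopologicalSpace X] {S T : Set X} (hST : S ⊆ T)
    (F : C(unitInterval × T, T)) (h0 : ∀ x, F (0, x) = x) (h1 : ∀ x, (F (1, x)).1 ∈ S)
    (hS : ∀ t x, x.1 ∈ S → F (t, x) = x) :
    IsHomotopyEquiv (ContinuousMap.inclusion hST) := by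
  let r : C(T, S) := ⟨fun x => ⟨(F (1, x)).1, h1 x⟩, by fun_prop⟩
  have hr : r.comp (ContinuousMap.inclusion hST) = ContinuousMap.id S :=
    ContinuousMap.ext fun x => Subtype.ext
      (congrArg (Subtype.val (p := (· ∈ T))) (hS 1 (Set.inclusion hST x) x.2))
  -- One composite is the identity of S; F joins the identity of T to the other.
  refine ⟨⟨ContinuousMap.inclusion hST, r, hr ▸ ContinuousMap.Homotopic.refl _,
    ContinuousMap.Homotopic.symm ⟨⟨F, h0, fun x => ?_⟩⟩⟩, rfl⟩
  rfl

theorem isHomotopyEquiv_inclusion_transversals {A : Fin (k + 1) → Set (Euc d)}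
    (hconv : ∀ i, Convex ℝ (A i)) (hcomp : ∀ i, IsCompact (A i))
    {α : Fin (k + 1) → Euc d} (hα : ∀ i, α i ∈ A i)
    (hind : ∀ v : Fin (k + 1) → Euc (d + 1), (∀ i, v i ∈ affLift '' A i) → LinearIndependent ℝ v)
    (hsub : transversals m (fun i => {α i}) ⊆ transversals m A) :
    IsHomotopyEquiv (ContinuousMap.inclusion hsub) := by
  obtain ⟨g, hg, hu, hg0, hg1, hgK, hgκ⟩ := exists_deformation
    (C := fun H : transversals m A => cone H.1.1) (K := fun i => affLift '' A i)
    (Plane.continuous_starProjection_cone.comp continuous_subtype_val)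
    (fun i => convex_image_affLift (hconv i)) (fun i => (hcomp i).image continuous_affLift)
    (fun v hv => hind v fun i => hv i trivial) (κ := fun i => affLift (α i))
    (fun i _ => ⟨α i, hα i, rfl⟩) (fun H => mem_transversals_iff.1 H.2)
  have hx : ∀ z : unitInterval × transversals m A,
      ∃ x, affLift x ∈ (cone z.2.1.1).map (g z : Euc (d + 1) →ₗ[ℝ] Euc (d + 1)) := fun z => by
    obtain ⟨_, ⟨x, -, rfl⟩, h⟩ := hgK z 0
    exact ⟨x, h⟩
  let f : unitInterval × transversals m A → Plane d m := fun z =>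
    Plane.ofSubmodule ((cone z.2.1.1).map (g z : Euc (d + 1) →ₗ[ℝ] Euc (d + 1)))
      ((finrank_map_of_isUnit (hu z) _).trans (finrank_cone _)) (hx z)
  have hcone : ∀ z, cone (f z).1 =
      (cone z.2.1.1).map (g z : Euc (d + 1) →ₗ[ℝ] Euc (d + 1)) := fun z => cone_ofSubmodule _ _ _
  have hf : Continuous f := by
    rw [Plane.continuous_iff]
    simp_rw [hcone]
    exact continuous_starProjection_map hg hu
      (Plane.continuous_starProjection_cone.comp (continuous_subtype_val.comp continuous_snd))
  have hfT : ∀ z, f z ∈ transversals m A := fun z => by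
    rw [mem_transversals_iff, hcone]
    exact hgK z
  have hf1 : ∀ z, g z = 1 → f z = z.2.1 := fun z hz => by
    apply cone_injective
    change cone (f z).1 = _
    rw [hcone, hz]
    exact Submodule.map_id _
  refine isHomotopyEquiv_of_deformation hsub ⟨fun z => ⟨f z, hfT z⟩, hf.subtype_mk _⟩
    (fun H => Subtype.ext (hf1 _ (hg0 H))) (fun H => ?_) (fun t H hH => Subtype.ext (hf1 _ ?_))
  · change f (1, H) ∈ _
    rw [← span_le_cone_iff, hcone, Submodule.span_le, Set.range_subset_iff]
    exact hg1 H
  · rw [← span_le_cone_iff, Submodule.span_le, Set.range_subset_iff] at hH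
    exact hgκ _ hH

end PlaneTransversal

end

theorem theorem2 (d ρ m : ℕ) (hρm : ρ < m) (hmd : m < d)
    (A : Fin (ρ + 2) → Set (PlaneTransversal.Euc d))
    (hconv : ∀ i, Convex ℝ (A i)) (hcomp : ∀ i, IsCompact (A i))
    (α : Fin (ρ + 2) → PlaneTransversal.Euc d) (hα : ∀ i, α i ∈ A i)
    (hno : ¬ ∃ H : PlaneTransversal.Plane d ρ, H ∈ PlaneTransversal.transversals ρ A) :
    PlaneTransversal.IsHomotopyEquiv
        (ContinuousMap.inclusion
          (PlaneTransversal.transversals_mono m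
            (fun i => Set.singleton_subset_iff.2 (hα i)) :
            PlaneTransversal.transversals m (fun i => {α i}) ⊆
              PlaneTransversal.transversals m A)) ∧
      Nonempty (PlaneTransversal.transversals m A ≃ₕ
        PlaneTransversal.Gr (d - ρ - 1) (m - ρ - 1)) ∧
      (m = ρ + 1 → ContractibleSpace (PlaneTransversal.transversals m A)) := by
  have hind : ∀ v : Fin (ρ + 2) → PlaneTransversal.Euc (d + 1),
      (∀ i, v i ∈ PlaneTransversal.affLift '' A i) → LinearIndependent ℝ v := fun v hv =>
    PlaneTransversal.linearIndependent_of_no_transversal (by omega) hno hv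
  have hincl := PlaneTransversal.isHomotopyEquiv_inclusion_transversals hconv hcomp hα hind
    (PlaneTransversal.transversals_mono m (fun i => Set.singleton_subset_iff.2 (hα i)))
  obtain ⟨e, -⟩ := id hincl
  -- The ρ + 2 points span dimension ρ + 2, so here k = ρ + 1; both subtractions are exact because ρ
  -- < m < d.
  obtain ⟨e'⟩ := PlaneTransversal.nonempty_homeomorph_transversals_singleton (m := m)
    (r := d - ρ - 1) (q := m - ρ - 1) (hind _ fun i => ⟨α i, hα i, rfl⟩) (by omega) (by omega)
  refine ⟨hincl, ⟨e.symm.trans e'.toHomotopyEquiv⟩, ?_⟩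
  rintro rfl
  -- The Grassmannian of 0-dimensional subspaces is a single point.
  have h0 : ρ + 1 - ρ - 1 = 0 := by omega
  rw [h0] at e'
  exact (e.symm.trans e'.toHomotopyEquiv).contractibleSpace
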